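/- A (possibly degenerate) semi-Riemannian manifold $(M,g)$ is a smooth (Hausdorff, second countable, finite-dimensional) manifold with a smooth symmetric $(0,2)$-tensor field $g$ of constant signature $(r,p,q)$ ($r$ zeros, $p$ minus signs, $q$ plus signs). Its radical is $\mathcal N(T_xM)=\{X\in T_xM : g(X,Y)=0 \text{ for all } Y\in T_xM\}$; put $\overline{T_xM}=T_xM/\mathcal N(T_xM)$ with the induced non-degenerate inner product $\overline g_x$. $(M,g)$ is stationary if $\mathcal L_Ag=0$ for every smooth local section $A$ of $\mathcal N(TM)$. The radical foliation of a stationary manifold is the foliation tangent to $\mathcal N(TM)$; two points lie on the same leaf iff they are joined by a piecewise $C^1$ path tangent to $\mathcal N(TM)$. It is simple if its leaves are the fibres of a smooth submersion of $M$ into a Hausdorff manifold. Then the leaf space $\overline M$, with the quotient topology, carries its smooth structure for which the projection $\pi_M:M\to\overline M$ is a smooth submersion. A $C^1$ map $\phi:(M,g)\to(N,h)$ is radical-preserving if $d\phi_x(\mathcal N(T_xM))\subseteq\mathcal N(T_{\phi(x)}N)$ for all $x\in M$. It then induces linear maps $\overline{d\phi}_x:\overline{T_xM}\to\overline{T_{\phi(x)}N}$,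 with adjoint $\overline{d\phi}_x^{\,*}$ with respect to $\overline g_x$ and $\overline h_{\phi(x)}$. It is generalized horizontally weakly conformal (generalized HWC) if there is a function $\Lambda:M\to\mathbb R$ with $$\overline g_x(\overline{d\phi}_x^{\,*}V,\overline{d\phi}_x^{\,*}W)=\Lambda(x)\,\overline h_{\phi(x)}(V,W)\qquad (x\in M,\ V,W\in\overline{T_{\phi(x)}N}).$$ A $C^1$ map between manifolds with non-degenerate metrics is HWC if it satisfies the same condition with tangent spaces, differential and metrics in place of their quotients. **Proposition.** Let $(M,g)$ and $(N,h)$ be stationary semi-Riemannian manifolds whose radical foliations are simple, with leaf spaces $\overline M,\overline N$, and let $\phi:M\to N$ be a $C^1$ radical-preserving map. Then: 1. The induced map $\overline\phi:\overline M\to\overline N$, $[x]\mapsto[\phi(x)]$, is well defined and $C^1$. There is a unique field $g^{\overline M}$ of bilinear forms on the tangent spaces of $\overline M$ with $g^{\overline M}(d\pi_M X,d\pi_M Y)=g(X,Y)$ for all $x\in M$ and $X,Y\in T_xM$, and likewise a unique $h^{\overline N}$ on $\overline N$ for $h$. Both are non-degenerate at every point. 2. $\phi:(M,g)\to(N,h)$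 is generalized HWC if and only if $\overline\phi:(\overline M,g^{\overline M})\to(\overline N,h^{\overline N})$ is HWC. -/

import Mathlib

open Set Topology
open scoped Manifold ContDiff Bundle

universe u v

/-! ### Linear algebra -/

section LinearAlgebra

variable {V W : Type*} [AddCommGroup V] [Module ℝ V] [AddCommGroup W] [Module ℝ W]

/-- `B` has signature `(r, p, q)`: there is a basis in which `B` is
`diag (0, …, 0, -1, …, -1, 1, …, 1)` with `r` zeros, `p` entries `-1` and `q` entries `1`. -/
def HasSignature (B : LinearMap.BilinForm ℝ V) (r p q : ℕ) : Prop :=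
  ∃ e : Module.Basis (Fin r ⊕ Fin p ⊕ Fin q) ℝ V, ∀ i j,
    B (e i) (e j) =
      if i = j then Sum.elim (fun _ => 0) (Sum.elim (fun _ => -1) (fun _ => 1)) i else 0

/-- The linear map `T` is the adjoint of `L : V → W` with respect to the inner products
`g` on `V` and `h` on `W`. -/
def IsAdjoint (g : LinearMap.BilinForm ℝ V) (h : LinearMap.BilinForm ℝ W)
    (L : V →ₗ[ℝ] W) (T : W →ₗ[ℝ] V) : Prop :=
  ∀ w v, g (T w) v = h w (L v)

/-- If `g` is non-degenerate, the adjoint exists and is unique. -/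
theorem existsUnique_isAdjoint [FiniteDimensional ℝ V] {g : LinearMap.BilinForm ℝ V}
    (hg : g.Nondegenerate) (h : LinearMap.BilinForm ℝ W) (L : V →ₗ[ℝ] W) :
    ∃! T : W →ₗ[ℝ] V, IsAdjoint g h L T := by
  refine ⟨(g.toDual hg).symm.toLinearMap ∘ₗ L.dualMap ∘ₗ h, ?_, ?_⟩
  · intro w v
    simp [LinearMap.BilinForm.apply_toDual_symm_apply]
  · intro T hT
    ext w
    apply (g.toDual hg).injective
    ext v
    simp [LinearMap.BilinForm.toDual_def, hT w v]

/-- `L : (V, g) → (W, h)` is horizontally weakly conformal with square dilation `c`: its adjoint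
`L*` satisfies `g (L* w) (L* w') = c * h w w'` for all `w, w'`. (This is used for non-degenerate
`g` only, where the adjoint exists and is unique.) -/
def IsHWCLinear (g : LinearMap.BilinForm ℝ V) (h : LinearMap.BilinForm ℝ W)
    (L : V →ₗ[ℝ] W) (c : ℝ) : Prop :=
  ∃ T : W →ₗ[ℝ] V, IsAdjoint g h L T ∧ ∀ w w', g (T w) (T w') = c * h w w'

end LinearAlgebra

/-! ### Semi-Riemannian metrics, possibly degenerate -/

/-- A smooth, possibly degenerate, semi-Riemannian metric on the `m`-dimensional manifold `M`:
a smooth symmetric covariant 2-tensor field of constant signature `(r, p, q)`. -/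
structure SemiRiemannianMetric (m : ℕ) (M : Type u) [TopologicalSpace M]
    [ChartedSpace (EuclideanSpace ℝ (Fin m)) M] [IsManifold (𝓡 m) ∞ M] where
  inner : ∀ x : M, TangentSpace (𝓡 m) x →L[ℝ] TangentSpace (𝓡 m) x →L[ℝ] ℝ
  symm : ∀ x v w, inner x v w = inner x w v
  contMDiff : ContMDiff (𝓡 m)
    ((𝓡 m).prod 𝓘(ℝ, EuclideanSpace ℝ (Fin m) →L[ℝ] EuclideanSpace ℝ (Fin m) →L[ℝ] ℝ)) ∞
    (fun x : M => Bundle.TotalSpace.mk'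
      (EuclideanSpace ℝ (Fin m) →L[ℝ] EuclideanSpace ℝ (Fin m) →L[ℝ] ℝ)
      (E := fun x : M => TangentSpace (𝓡 m) x →L[ℝ] TangentSpace (𝓡 m) x →L[ℝ] ℝ)
      x (inner x))
  signature : ∃ r p q : ℕ, ∀ x,
    HasSignature ((ContinuousLinearMap.coeLM ℝ) ∘ₗ (inner x).toLinearMap) r p q

section Metric

variable {m : ℕ} {M : Type u} [TopologicalSpace M]
  [ChartedSpace (EuclideanSpace ℝ (Fin m)) M] [IsManifold (𝓡 m) ∞ M]

namespace SemiRiemannianMetric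

/-- The metric at `x` as a bilinear form on `T_x M`. -/
noncomputable def form (g : SemiRiemannianMetric m M) (x : M) :
    LinearMap.BilinForm ℝ (TangentSpace (𝓡 m) x) :=
  (ContinuousLinearMap.coeLM ℝ) ∘ₗ (g.inner x).toLinearMap

theorem form_apply (g : SemiRiemannianMetric m M) (x : M) (v w : TangentSpace (𝓡 m) x) :
    g.form x v w = g.inner x v w := rfl

theorem form_isRefl (g : SemiRiemannianMetric m M) (x : M) : (g.form x).IsRefl := by
  intro v w h
  rw [form_apply] at h ⊢
  rw [g.symm, h]

/-- The radical `𝒩(T_x M) = {X | g(X, Y) = 0 for all Y}`. -/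
noncomputable def radical (g : SemiRiemannianMetric m M) (x : M) : Submodule ℝ (TangentSpace (𝓡 m) x) :=
  LinearMap.ker (g.form x)

theorem mem_radical (g : SemiRiemannianMetric m M) (x : M) (v : TangentSpace (𝓡 m) x) :
    v ∈ g.radical x ↔ ∀ w, g.inner x v w = 0 := by
  simp [radical, LinearMap.ext_iff, form_apply]

/-- The form induced by `g` on the quotient tangent space `T_x M ⧸ 𝒩(T_x M)`. -/
noncomputable def quotForm (g : SemiRiemannianMetric m M) (x : M) :
    LinearMap.BilinForm ℝ (TangentSpace (𝓡 m) x ⧸ g.radical x) :=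
  (g.form_isRefl x).liftQ₂ (g.form x) (g.radical x) le_rfl

theorem quotForm_mk (g : SemiRiemannianMetric m M) (x : M) (v w : TangentSpace (𝓡 m) x) :
    g.quotForm x (Submodule.Quotient.mk v) (Submodule.Quotient.mk w) = g.inner x v w := rfl

theorem quotForm_nondegenerate (g : SemiRiemannianMetric m M) (x : M) :
    (g.quotForm x).Nondegenerate := by
  constructor
  · intro v
    induction v using Submodule.Quotient.induction_on with
    | _ v =>
      intro h
      rw [Submodule.Quotient.mk_eq_zero, mem_radical]
      exact fun w => h (Submodule.Quotient.mk w)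
  · intro v
    induction v using Submodule.Quotient.induction_on with
    | _ v =>
      intro h
      rw [Submodule.Quotient.mk_eq_zero, mem_radical]
      intro w
      rw [g.symm]
      exact h (Submodule.Quotient.mk w)

/-- `(L_A g)(X, Y) = A (g(X, Y)) - g([A, X], Y) - g(X, [A, Y])` at `x`, for vector fields
`A, X, Y` defined near `x`. -/
noncomputable def lieDeriv (g : SemiRiemannianMetric m M)
    (A X Y : ∀ x : M, TangentSpace (𝓡 m) x) (x : M) : ℝ :=
  mvfderiv (𝓡 m) (fun y => g.inner y (X y) (Y y)) x (A x)
    - g.inner x (VectorField.mlieBracket (𝓡 m) A X x) (Y x)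
    - g.inner x (X x) (VectorField.mlieBracket (𝓡 m) A Y x)

/-- The vector field `X` is smooth on `U`. -/
def _root_.IsSmoothFieldOn (X : ∀ x : M, TangentSpace (𝓡 m) x) (U : Set M) : Prop :=
  ContMDiffOn (𝓡 m) (𝓡 m).tangent ∞ (fun x => (⟨x, X x⟩ : TangentBundle (𝓡 m) M)) U

/-- `(M, g)` is stationary: `L_A g = 0` for every local smooth section `A` of the radical
distribution. -/
def IsStationary (g : SemiRiemannianMetric m M) : Prop :=
  ∀ (U : Set M) (A X Y : ∀ x : M, TangentSpace (𝓡 m) x), IsOpen U →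
    IsSmoothFieldOn A U → IsSmoothFieldOn X U → IsSmoothFieldOn Y U →
    (∀ x ∈ U, A x ∈ g.radical x) → ∀ x ∈ U, g.lieDeriv A X Y x = 0

/-! ### The radical foliation and its leaf space -/

/-- `x` and `y` are joined by a `C¹` path tangent to the radical distribution. -/
def RadicalJoined (g : SemiRiemannianMetric m M) (x y : M) : Prop :=
  ∃ γ : ℝ → M, ContMDiffOn 𝓘(ℝ, ℝ) (𝓡 m) 1 γ (Icc 0 1) ∧ γ 0 = x ∧ γ 1 = y ∧
    ∀ t ∈ Icc (0 : ℝ) 1,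
      mfderivWithin 𝓘(ℝ, ℝ) (𝓡 m) γ (Icc 0 1) t (1 : ℝ) ∈ g.radical (γ t)

/-- `x` and `y` lie on the same leaf of the radical foliation: they are joined by a piecewise `C¹`
path tangent to the radical distribution. -/
def leafSetoid (g : SemiRiemannianMetric m M) : Setoid M :=
  Relation.EqvGen.setoid g.RadicalJoined

/-- The leaf space of the radical foliation. -/
def LeafSpace (g : SemiRiemannianMetric m M) : Type u := Quotient g.leafSetoid

/-- The leaf space carries the quotient topology. -/
instance (g : SemiRiemannianMetric m M) : TopologicalSpace g.LeafSpace :=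
  inferInstanceAs (TopologicalSpace (Quotient g.leafSetoid))

/-- The natural projection of `M` onto the leaf space. -/
def leafProj (g : SemiRiemannianMetric m M) (x : M) : g.LeafSpace :=
  Quotient.mk g.leafSetoid x

/-- The radical foliation is simple: its leaves (which are tangent to the radical distribution) are
the fibres of a smooth submersion of `M` into a Hausdorff smooth manifold. -/
def IsSimple (g : SemiRiemannianMetric m M) : Prop :=
  ∃ (k : ℕ) (B : Type u) (_ : TopologicalSpace B) (_ : T2Space B)
    (_ : ChartedSpace (EuclideanSpace ℝ (Fin k)) B) (_ : IsManifold (𝓡 k) ∞ B) (f : M → B),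
    Manifold.IsSubmersion (𝓡 m) (𝓡 k) ∞ f ∧
    (∀ x y, f x = f y ↔ g.leafSetoid x y) ∧
    ∀ x, LinearMap.ker (mfderiv (𝓡 m) (𝓡 k) f x).toLinearMap = g.radical x

/-- The bilinear forms `gbar` on the tangent spaces of the leaf space are the metric induced by
`g`: `gbar (dπ X) (dπ Y) = g (X, Y)` for all `x` and all `X, Y ∈ T_x M`. -/
def IsInducedMetric {k : ℕ} (g : SemiRiemannianMetric m M)
    [ChartedSpace (EuclideanSpace ℝ (Fin k)) g.LeafSpace]
    (gbar : ∀ b : g.LeafSpace, LinearMap.BilinForm ℝ (TangentSpace (𝓡 k) b)) : Prop :=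
  ∀ (x : M) (X Y : TangentSpace (𝓡 m) x),
    gbar (g.leafProj x) (mfderiv (𝓡 m) (𝓡 k) g.leafProj x X)
      (mfderiv (𝓡 m) (𝓡 k) g.leafProj x Y) = g.inner x X Y

end SemiRiemannianMetric

end Metric

/-! ### Radical-preserving maps and horizontal weak conformality -/

/-- `φ : M → N`, between manifolds whose tangent spaces carry the inner products `g` and `h`, `g`
non-degenerate, is horizontally weakly conformal, with some square dilation `Λ : M → ℝ`. -/
def IsHWC {m n : ℕ} {M : Type u} [TopologicalSpace M]
    [ChartedSpace (EuclideanSpace ℝ (Fin m)) M] {N : Type v} [TopologicalSpace N]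
    [ChartedSpace (EuclideanSpace ℝ (Fin n)) N]
    (g : ∀ x : M, LinearMap.BilinForm ℝ (TangentSpace (𝓡 m) x))
    (h : ∀ y : N, LinearMap.BilinForm ℝ (TangentSpace (𝓡 n) y)) (φ : M → N) : Prop :=
  ∃ Λ : M → ℝ, ∀ x,
    IsHWCLinear (g x) (h (φ x)) (mfderiv (𝓡 m) (𝓡 n) φ x).toLinearMap (Λ x)

section Maps

variable {m n : ℕ} {M : Type u} [TopologicalSpace M]
  [ChartedSpace (EuclideanSpace ℝ (Fin m)) M] [IsManifold (𝓡 m) ∞ M]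
  {N : Type v} [TopologicalSpace N]
  [ChartedSpace (EuclideanSpace ℝ (Fin n)) N] [IsManifold (𝓡 n) ∞ N]

/-- `φ` is radical-preserving: `dφ_x` maps `𝒩(T_x M)` into `𝒩(T_{φ(x)} N)` for each `x`. -/
def IsRadicalPreserving (g : SemiRiemannianMetric m M) (h : SemiRiemannianMetric n N)
    (φ : M → N) : Prop :=
  ∀ x, g.radical x ≤ (h.radical (φ x)).comap (mfderiv (𝓡 m) (𝓡 n) φ x).toLinearMap

variable {g : SemiRiemannianMetric m M} {h : SemiRiemannianMetric n N} {φ : M → N}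

/-- The generalized differential `T_x M ⧸ 𝒩(T_x M) → T_{φ(x)} N ⧸ 𝒩(T_{φ(x)} N)`. -/
noncomputable def genDifferential (hrad : IsRadicalPreserving g h φ) (x : M) :
    (TangentSpace (𝓡 m) x ⧸ g.radical x) →ₗ[ℝ] (TangentSpace (𝓡 n) (φ x) ⧸ h.radical (φ x)) :=
  Submodule.mapQ _ _ (mfderiv (𝓡 m) (𝓡 n) φ x).toLinearMap (hrad x)

/-- `φ` is generalized horizontally weakly conformal, with some square dilation `Λ : M → ℝ`. -/
def IsGenHWC (hrad : IsRadicalPreserving g h φ) : Prop :=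
  ∃ Λ : M → ℝ, ∀ x,
    IsHWCLinear (g.quotForm x) (h.quotForm (φ x)) (genDifferential hrad x) (Λ x)

theorem RadicalJoined.map (hφ : ContMDiff (𝓡 m) (𝓡 n) 1 φ) (hrad : IsRadicalPreserving g h φ)
    {x y : M} (hxy : g.RadicalJoined x y) : h.RadicalJoined (φ x) (φ y) := by
  obtain ⟨γ, hγ, h0, h1, ht⟩ := hxy
  refine ⟨φ ∘ γ, hφ.comp_contMDiffOn hγ, by simp [h0], by simp [h1], fun t htI => ?_⟩
  have hu : UniqueMDiffWithinAt 𝓘(ℝ, ℝ) (Icc (0 : ℝ) 1) t :=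
    (uniqueDiffOn_Icc_zero_one t htI).uniqueMDiffWithinAt
  rw [mfderiv_comp_mfderivWithin t ((hφ (γ t)).mdifferentiableAt one_ne_zero)
    ((hγ t htI).mdifferentiableWithinAt one_ne_zero) hu]
  exact hrad (γ t) (ht t htI)

/-- The map `[x] ↦ [φ(x)]` between the leaf spaces induced by a `C¹` radical-preserving map. -/
def leafMap (hφ : ContMDiff (𝓡 m) (𝓡 n) 1 φ) (hrad : IsRadicalPreserving g h φ) :
    g.LeafSpace → h.LeafSpace :=
  Quotient.map φ fun _ _ hxy => by
    induction hxy with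
    | rel x y hxy => exact Relation.EqvGen.rel _ _ (RadicalJoined.map hφ hrad hxy)
    | refl x => exact Relation.EqvGen.refl _
    | symm x y _ ih => exact Relation.EqvGen.symm _ _ ih
    | trans x y z _ _ ih₁ ih₂ => exact Relation.EqvGen.trans _ _ _ ih₁ ih₂

theorem leafMap_leafProj (hφ : ContMDiff (𝓡 m) (𝓡 n) 1 φ) (hrad : IsRadicalPreserving g h φ)
    (x : M) : leafMap hφ hrad (g.leafProj x) = h.leafProj (φ x) := rfl

end Maps

/-! The main point is that `g` descends to the leaf space. Take charts in which the projection is a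
linear map `P`, and a vector `a` with `P a = 0`. The field constantly equal to `a` is radical, and
it commutes with every constant field. So `L_A g = 0` says that the coefficients of `g` do not
change in direction `a` (`IsStationary.inner_chartField_eq`). Hence nearby points of a fibre induce
the same form on the base (`eventually_sameTransverse`), and connectedness of the interval extends
this along radical paths, so over whole leaves (`IsStationary.sameTransverse`).

The kernel of the differential of `leafProj` is exactly the radical, because submersions with the
same fibres have the same kernels. So `quotEquiv` is an isometry from each quotient tangent space to
a tangent space of the leaf space. This gives non-degeneracy. These isometries also intertwine the
generalized differential with the differential of `leafMap`, so the two conformality conditions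
agree point by point. Regularity of `leafMap` comes from smooth local sections of the projection. -/

/-! ### Submersions: local sections, descent of maps, kernels. -/

section Submersion

variable {m k : ℕ} {M : Type*} [TopologicalSpace M] [ChartedSpace (EuclideanSpace ℝ (Fin m)) M]
  {B : Type*} [TopologicalSpace B] [ChartedSpace (EuclideanSpace ℝ (Fin k)) B] {f : M → B}

/-- Around every point a submersion is, in suitable charts, a linear map with a right inverse. -/
theorem Manifold.IsSubmersion.exists_charts (hf : Manifold.IsSubmersion (𝓡 m) (𝓡 k) ∞ f) (x : M) :
    ∃ (ψ : OpenPartialHomeomorph M (EuclideanSpace ℝ (Fin m)))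
      (χ : OpenPartialHomeomorph B (EuclideanSpace ℝ (Fin k)))
      (P : EuclideanSpace ℝ (Fin m) →L[ℝ] EuclideanSpace ℝ (Fin k))
      (R : EuclideanSpace ℝ (Fin k) →L[ℝ] EuclideanSpace ℝ (Fin m)),
      x ∈ ψ.source ∧ ψ ∈ IsManifold.maximalAtlas (𝓡 m) ∞ M ∧
      χ ∈ IsManifold.maximalAtlas (𝓡 k) ∞ B ∧ MapsTo f ψ.source χ.source ∧
      (∀ y ∈ ψ.source, χ (f y) = P (ψ y)) ∧ ∀ v, P (R v) = v := by
  obtain ⟨F, _, _, hF⟩ := hf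
  have h := hF x
  refine ⟨h.domChart, h.codChart, (ContinuousLinearMap.fst ℝ _ F) ∘L h.equiv.toContinuousLinearMap,
    h.equiv.symm.toContinuousLinearMap ∘L (ContinuousLinearMap.inl ℝ _ F), h.mem_domChart_source,
    h.domChart_mem_maximalAtlas, h.codChart_mem_maximalAtlas,
    h.mapsto_domChart_source_codChart_source, fun y hy => ?_, fun v => by simp⟩
  have key := h.writtenInCharts
  have := @key (h.domChart y) (by simpa using h.domChart.map_source hy)
  simpa [h.domChart.left_inv hy] using this

/-- A submersion has a smooth local section through every point. -/
theorem Manifold.IsSubmersion.exists_section [IsManifold (𝓡 m) ∞ M]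
    (hf : Manifold.IsSubmersion (𝓡 m) (𝓡 k) ∞ f) (x : M) :
    ∃ s : B → M, s (f x) = x ∧ ContMDiffAt (𝓡 k) (𝓡 m) ∞ s (f x) ∧
      ∀ᶠ b in 𝓝 (f x), f (s b) = b := by
  obtain ⟨ψ, χ, P, R, hx, hψ, hχ, hmaps, hP, hR⟩ := hf.exists_charts x
  have hfx : f x ∈ χ.source := hmaps hx
  -- The right inverse `R` of `P`, translated to send `χ (f x)` to `ψ x`; read back through the
  -- charts it is the section.
  let σ : EuclideanSpace ℝ (Fin k) → EuclideanSpace ℝ (Fin m) := fun v => ψ x + R (v - χ (f x))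
  have hσ : ContDiff ℝ ∞ σ := by fun_prop
  have hσx : σ (χ (f x)) = ψ x := by simp [σ]
  have hσχ : ContMDiffAt (𝓡 k) (𝓡 m) ∞ (fun b => σ (χ b)) (f x) :=
    hσ.contMDiff.contMDiffAt.comp (f x) (contMDiffAt_of_mem_maximalAtlas hχ hfx)
  refine ⟨fun b => ψ.symm (σ (χ b)), by simp [hσx, hx], ?_, ?_⟩
  · refine ContMDiffAt.comp (f x) (g := ψ.symm) ?_ hσχ
    rw [hσx]
    exact contMDiffAt_symm_of_mem_maximalAtlas hψ (ψ.map_source hx)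
  · have h1 : ∀ᶠ b in 𝓝 (f x), σ (χ b) ∈ ψ.target :=
      hσχ.continuousAt.eventually_mem (by rw [hσx]; exact ψ.open_target.mem_nhds (ψ.map_source hx))
    filter_upwards [h1, χ.open_source.mem_nhds hfx] with b hb hbχ
    have hb' := ψ.map_target hb
    apply χ.injOn (hmaps hb') hbχ
    rw [hP _ hb', ψ.right_inv hb]
    simp only [σ, map_add, hR, ← hP x hx]
    abel

theorem Manifold.IsSubmersion.mdifferentiableAt [IsManifold (𝓡 m) ∞ M] [IsManifold (𝓡 k) ∞ B]
    (hf : Manifold.IsSubmersion (𝓡 m) (𝓡 k) ∞ f) (x : M) :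
    MDifferentiableAt (𝓡 m) (𝓡 k) f x :=
  (hf.contMDiff x).mdifferentiableAt (by simp)

theorem Manifold.IsSubmersion.surjective_mfderiv [IsManifold (𝓡 m) ∞ M] [IsManifold (𝓡 k) ∞ B]
    (hf : Manifold.IsSubmersion (𝓡 m) (𝓡 k) ∞ f) (x : M) :
    Function.Surjective (mfderiv (𝓡 m) (𝓡 k) f x) := by
  obtain ⟨s, hsx, hs, hfs⟩ := hf.exists_section x
  intro v
  have h1 : HasMFDerivAt (𝓡 k) (𝓡 m) s (f x) (mfderiv (𝓡 k) (𝓡 m) s (f x)) :=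
    (hs.mdifferentiableAt (by simp)).hasMFDerivAt
  have h2 : HasMFDerivAt (𝓡 m) (𝓡 k) f (s (f x)) (mfderiv (𝓡 m) (𝓡 k) f (s (f x))) :=
    (hf.mdifferentiableAt _).hasMFDerivAt
  -- Differentiating `f ∘ s = id` near `f x` makes `ds` a right inverse of `df`.
  have h3 := (h2.comp (f x) h1).congr_of_eventuallyEq (f₁ := id)
    (hfs.mono fun b hb => hb.symm)
  have h4 := hasMFDerivAt_unique h3 (hasMFDerivAt_id (f x))
  have h5 := DFunLike.congr_fun h4 v
  rw [hsx] at h5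
  exact ⟨_, h5⟩

variable {l : ℕ} {C : Type*} [TopologicalSpace C] [ChartedSpace (EuclideanSpace ℝ (Fin l)) C]

/-- A `C^r` map which is constant on the fibres of a submersion factors through it by `C^r` maps. -/
theorem Manifold.IsSubmersion.contMDiffAt_of_comp [IsManifold (𝓡 m) ∞ M]
    (hf : Manifold.IsSubmersion (𝓡 m) (𝓡 k) ∞ f) {r : ℕ∞} {F : B → C} (x : M)
    (hF : ContMDiffAt (𝓡 m) (𝓡 l) r (F ∘ f) x) : ContMDiffAt (𝓡 k) (𝓡 l) r F (f x) := by
  obtain ⟨s, hsx, hs, hfs⟩ := hf.exists_section x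
  have h : ContMDiffAt (𝓡 k) (𝓡 l) r ((F ∘ f) ∘ s) (f x) := by
    refine ContMDiffAt.comp (f x) ?_ (hs.of_le (by exact_mod_cast le_top))
    rwa [hsx]
  exact h.congr_of_eventuallyEq (hfs.mono fun b hb => by simp [hb])

/-- If `f'` is constant on the fibres of the submersion `f`, then `ker df ⊆ ker df'`. -/
theorem Manifold.IsSubmersion.mfderiv_eq_zero [IsManifold (𝓡 m) ∞ M] [IsManifold (𝓡 k) ∞ B]
    (hf : Manifold.IsSubmersion (𝓡 m) (𝓡 k) ∞ f) {f' : M → C} {x : M}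
    (hf' : MDifferentiableAt (𝓡 m) (𝓡 l) f' x) (hff' : ∀ y z, f y = f z → f' y = f' z)
    {v : TangentSpace (𝓡 m) x} (hv : mfderiv (𝓡 m) (𝓡 k) f x v = 0) :
    mfderiv (𝓡 m) (𝓡 l) f' x v = 0 := by
  obtain ⟨s, hsx, hs, hfs⟩ := hf.exists_section x
  have h1 : MDifferentiableAt (𝓡 k) (𝓡 l) (f' ∘ s) (f x) := by
    refine MDifferentiableAt.comp (f x) ?_ (hs.mdifferentiableAt (by simp))
    rwa [hsx]
  -- Near `x`, `f' = (f' ∘ s) ∘ f`, since `s (f y)` and `y` lie in the same fibre of `f`; so `df'`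
  -- factors through `df`.
  have h2 := (h1.hasMFDerivAt.comp x (hf.mdifferentiableAt x).hasMFDerivAt).congr_of_eventuallyEq
    (f₁ := f') (((hf.mdifferentiableAt x).continuousAt.eventually hfs).mono
      fun y hy => hff' _ _ hy.symm)
  rw [h2.mfderiv]
  change mfderiv (𝓡 k) (𝓡 l) (f' ∘ s) (f x) (mfderiv (𝓡 m) (𝓡 k) f x v) = 0
  rw [hv, map_zero]

end Submersion

/-! ### Invariance of weak conformality under isometries. -/

section LinearAlgebra

variable {V W V' W' : Type*} [AddCommGroup V] [Module ℝ V] [AddCommGroup W] [Module ℝ W]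
  [AddCommGroup V'] [Module ℝ V'] [AddCommGroup W'] [Module ℝ W']
  {g : LinearMap.BilinForm ℝ V} {h : LinearMap.BilinForm ℝ W}
  {g' : LinearMap.BilinForm ℝ V'} {h' : LinearMap.BilinForm ℝ W'}
  {L : V →ₗ[ℝ] W} {L' : V' →ₗ[ℝ] W'} {c : ℝ}

/-- Conjugating an adjoint `T` by the isometries, `α T β⁻¹`, gives an adjoint of the conjugated map.
-/
theorem IsHWCLinear.of_equiv (α : V ≃ₗ[ℝ] V') (β : W ≃ₗ[ℝ] W')
    (hα : ∀ v w, g' (α v) (α w) = g v w) (hβ : ∀ v w, h' (β v) (β w) = h v w)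
    (hL : ∀ v, L' (α v) = β (L v)) (hc : IsHWCLinear g h L c) : IsHWCLinear g' h' L' c := by
  obtain ⟨T, hT, hTc⟩ := hc
  refine ⟨α.toLinearMap ∘ₗ T ∘ₗ β.symm.toLinearMap, fun w v => ?_, fun w w' => ?_⟩
  · obtain ⟨w, rfl⟩ := β.surjective w
    obtain ⟨v, rfl⟩ := α.surjective v
    simp [hα, hβ, hL, hT w v]
  · obtain ⟨w, rfl⟩ := β.surjective w
    obtain ⟨w', rfl⟩ := β.surjective w'
    simp [hα, hβ, hTc]

theorem isHWCLinear_iff_of_equiv (α : V ≃ₗ[ℝ] V') (β : W ≃ₗ[ℝ] W')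
    (hα : ∀ v w, g' (α v) (α w) = g v w) (hβ : ∀ v w, h' (β v) (β w) = h v w)
    (hL : ∀ v, L' (α v) = β (L v)) : IsHWCLinear g h L c ↔ IsHWCLinear g' h' L' c :=
  ⟨.of_equiv α β hα hβ hL, .of_equiv α.symm β.symm
    (fun v w => by simp [← hα]) (fun v w => by simp [← hβ])
    (fun v => β.injective (by simp [← hL]))⟩

end LinearAlgebra

/-! ### Vector fields with constant coefficients in a chart. -/

section ChartField

attribute [local instance] chartedSpaceSelf

variable {m : ℕ} {M : Type*} [TopologicalSpace M] [ChartedSpace (EuclideanSpace ℝ (Fin m)) M]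
  [IsManifold (𝓡 m) ∞ M]
  {ψ : OpenPartialHomeomorph M (EuclideanSpace ℝ (Fin m))}

/-- The vector field which is constant equal to `v` in the chart `ψ`. -/
noncomputable def chartField (ψ : OpenPartialHomeomorph M (EuclideanSpace ℝ (Fin m)))
    (v : EuclideanSpace ℝ (Fin m)) (x : M) : TangentSpace (𝓡 m) x :=
  VectorField.mpullback (𝓡 m) (𝓡 m) ψ (fun _ => v) x

omit [IsManifold (𝓡 m) ∞ M] in
theorem mdifferentiable_of_mem_maximalAtlas (hψ : ψ ∈ IsManifold.maximalAtlas (𝓡 m) ∞ M) :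
    ψ.MDifferentiable (𝓡 m) (𝓡 m) :=
  ⟨(contMDiffOn_of_mem_maximalAtlas hψ).mdifferentiableOn (by simp),
    (contMDiffOn_symm_of_mem_maximalAtlas hψ).mdifferentiableOn (by simp)⟩

omit [IsManifold (𝓡 m) ∞ M] in
theorem isInvertible_mfderiv_of_mem_maximalAtlas (hψ : ψ ∈ IsManifold.maximalAtlas (𝓡 m) ∞ M)
    {x : M} (hx : x ∈ ψ.source) : (mfderiv (𝓡 m) (𝓡 m) ψ x).IsInvertible :=
  ⟨(mdifferentiable_of_mem_maximalAtlas hψ).mfderiv hx, rfl⟩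

omit [IsManifold (𝓡 m) ∞ M] in
theorem mfderiv_chartField (hψ : ψ ∈ IsManifold.maximalAtlas (𝓡 m) ∞ M)
    {x : M} (hx : x ∈ ψ.source) (v : EuclideanSpace ℝ (Fin m)) :
    mfderiv (𝓡 m) (𝓡 m) ψ x (chartField ψ v x) = v :=
  (isInvertible_mfderiv_of_mem_maximalAtlas hψ hx).self_apply_inverse v

omit [IsManifold (𝓡 m) ∞ M] in
theorem chartField_mfderiv (hψ : ψ ∈ IsManifold.maximalAtlas (𝓡 m) ∞ M)
    {x : M} (hx : x ∈ ψ.source) (X : TangentSpace (𝓡 m) x) :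
    chartField ψ (mfderiv (𝓡 m) (𝓡 m) ψ x X) x = X :=
  (isInvertible_mfderiv_of_mem_maximalAtlas hψ hx).inverse_apply_self X

omit [IsManifold (𝓡 m) ∞ M] in
theorem chartField_sub (v w : EuclideanSpace ℝ (Fin m)) (x : M) :
    chartField ψ (v - w) x = chartField ψ v x - chartField ψ w x :=
  map_sub (mfderiv (𝓡 m) (𝓡 m) ψ x).inverse v w

theorem mlieBracket_eq_lieBracket {E : Type*} [NormedAddCommGroup E] [NormedSpace ℝ E]
    (V W : ∀ p : E, TangentSpace 𝓘(ℝ, E) p) (p : E) :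
    VectorField.mlieBracket 𝓘(ℝ, E) V W p = VectorField.lieBracket ℝ V W p := by
  rw [← VectorField.mlieBracketWithin_univ, VectorField.mlieBracketWithin_eq_lieBracketWithin]
  exact congrFun (VectorField.lieBracketWithin_univ (𝕜 := ℝ)) p

theorem mlieBracket_const {E : Type*} [NormedAddCommGroup E] [NormedSpace ℝ E] (v w p : E) :
    VectorField.mlieBracket 𝓘(ℝ, E) (fun _ : E => (v : E)) (fun _ => w) p = (0 : E) :=
  (mlieBracket_eq_lieBracket _ _ p).trans (by simp [VectorField.lieBracket]; rfl)

theorem contMDiff_const_field (v : EuclideanSpace ℝ (Fin m)) :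
    ContMDiff (𝓡 m) (𝓡 m).tangent ∞ (fun p : EuclideanSpace ℝ (Fin m) =>
      (⟨p, v⟩ : TangentBundle (𝓡 m) (EuclideanSpace ℝ (Fin m)))) := by
  exact contMDiff_vectorSpace_iff_contDiff.2 contDiff_const

theorem isSmoothFieldOn_chartField (hψ : ψ ∈ IsManifold.maximalAtlas (𝓡 m) ∞ M)
    (v : EuclideanSpace ℝ (Fin m)) : IsSmoothFieldOn (chartField ψ v) ψ.source := fun x hx =>
  (ContMDiffAt.mpullback_vectorField_preimage (contMDiff_const_field v (ψ x))
    (contMDiffAt_of_mem_maximalAtlas hψ hx) (isInvertible_mfderiv_of_mem_maximalAtlas hψ hx)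
    (by simp)).contMDiffWithinAt

/-- The bracket is natural under pullback by `ψ`, and constant fields commute. This removes both
bracket terms from `lieDeriv`. -/
theorem mlieBracket_chartField (hψ : ψ ∈ IsManifold.maximalAtlas (𝓡 m) ∞ M)
    {x : M} (hx : x ∈ ψ.source) (v w : EuclideanSpace ℝ (Fin m)) :
    VectorField.mlieBracket (𝓡 m) (chartField ψ v) (chartField ψ w) x = 0 := by
  have : IsManifold (𝓡 m) (minSmoothness ℝ 2) M := by
    rw [minSmoothness_of_isRCLikeNormedField]
    exact IsManifold.of_le (n := ∞) (by exact ENat.LEInfty.out)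
  have h := VectorField.mpullback_mlieBracket (I := 𝓡 m) (I' := 𝓡 m) (f := ψ) (x₀ := x) (n := ∞)
    ((contMDiff_const_field v (ψ x)).mdifferentiableAt (by simp))
    ((contMDiff_const_field w (ψ x)).mdifferentiableAt (by simp))
    (contMDiffAt_of_mem_maximalAtlas hψ hx) (by
      rw [minSmoothness_of_isRCLikeNormedField]; exact ENat.LEInfty.out)
  change _ = VectorField.mlieBracket (𝓡 m) (chartField ψ v) (chartField ψ w) x at h
  rw [← h, VectorField.mpullback_apply]
  exact (congrArg _ (mlieBracket_const v w (ψ x))).trans (map_zero _)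

end ChartField

/-! ### A stationary metric in chart coordinates. -/

namespace SemiRiemannianMetric

attribute [local instance] chartedSpaceSelf

variable {m : ℕ} {M : Type u} [TopologicalSpace M]
  [ChartedSpace (EuclideanSpace ℝ (Fin m)) M] [IsManifold (𝓡 m) ∞ M]
  {ψ : OpenPartialHomeomorph M (EuclideanSpace ℝ (Fin m))}

theorem mdifferentiableAt_inner_chartField (g : SemiRiemannianMetric m M)
    (hψ : ψ ∈ IsManifold.maximalAtlas (𝓡 m) ∞ M) {x : M} (hx : x ∈ ψ.source)
    (v w : EuclideanSpace ℝ (Fin m)) :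
    MDifferentiableAt (𝓡 m) 𝓘(ℝ, ℝ)
      (fun y => g.inner y (chartField ψ v y) (chartField ψ w y)) x := by
  have hs (v) : ContMDiffAt (𝓡 m) (𝓡 m).tangent ∞
      (fun x => (⟨x, chartField ψ v x⟩ : TangentBundle (𝓡 m) M)) x :=
    (isSmoothFieldOn_chartField hψ v).contMDiffAt (ψ.open_source.mem_nhds hx)
  have h := ContMDiffAt.clm_bundle_apply₂ (E₃ := Bundle.Trivial M ℝ) (F₃ := ℝ) (b := id)
    (g.contMDiff x) (hs v) (hs w)
  rw [Bundle.contMDiffAt_totalSpace] at h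
  exact h.2.mdifferentiableAt (by simp)

/-- The coefficients of a stationary metric in a chart are constant along radical directions. -/
theorem IsStationary.mvfderiv_inner_chartField {g : SemiRiemannianMetric m M} (hg : g.IsStationary)
    (hψ : ψ ∈ IsManifold.maximalAtlas (𝓡 m) ∞ M) {a : EuclideanSpace ℝ (Fin m)}
    (ha : ∀ y ∈ ψ.source, chartField ψ a y ∈ g.radical y) {x : M} (hx : x ∈ ψ.source)
    (v w : EuclideanSpace ℝ (Fin m)) :
    mvfderiv (𝓡 m) (fun y => g.inner y (chartField ψ v y) (chartField ψ w y)) x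
      (chartField ψ a x) = 0 := by
  have h := hg ψ.source _ _ _ ψ.open_source (isSmoothFieldOn_chartField hψ a)
    (isSmoothFieldOn_chartField hψ v) (isSmoothFieldOn_chartField hψ w) ha x hx
  simpa [lieDeriv, mlieBracket_chartField hψ hx] using h

/-- Integrates the vanishing derivative along the segment from `p` to `p + a`, which must stay in
the chart. -/
theorem IsStationary.inner_chartField_eq {g : SemiRiemannianMetric m M} (hg : g.IsStationary)
    (hψ : ψ ∈ IsManifold.maximalAtlas (𝓡 m) ∞ M) {a : EuclideanSpace ℝ (Fin m)}
    (ha : ∀ y ∈ ψ.source, chartField ψ a y ∈ g.radical y) {p : EuclideanSpace ℝ (Fin m)}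
    (hp : ∀ t ∈ Icc (0 : ℝ) 1, p + t • a ∈ ψ.target) (v w : EuclideanSpace ℝ (Fin m)) :
    g.inner (ψ.symm (p + a)) (chartField ψ v _) (chartField ψ w _) =
      g.inner (ψ.symm p) (chartField ψ v _) (chartField ψ w _) := by
  let H : M → ℝ := fun y => g.inner y (chartField ψ v y) (chartField ψ w y)
  let c : ℝ → EuclideanSpace ℝ (Fin m) := fun t => p + t • a
  have hc : ∀ t, HasMFDerivAt 𝓘(ℝ, ℝ) (𝓡 m) c t (ContinuousLinearMap.toSpanSingleton ℝ a) := by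
    intro t
    have : HasDerivAt c a t := by
      simpa [c] using ((hasDerivAt_id t).smul_const a).const_add p
    exact this.hasFDerivAt.hasMFDerivAt
  have hd : ∀ t ∈ Icc (0 : ℝ) 1, HasDerivAt (fun t => H (ψ.symm (c t))) 0 t := by
    intro t ht
    have hct : c t ∈ ψ.target := hp t ht
    have hs := ψ.map_target hct
    have h1 := ((mdifferentiable_of_mem_maximalAtlas hψ).symm.mdifferentiableAt hct).hasMFDerivAt
    have h2 := (g.mdifferentiableAt_inner_chartField hψ hs v w).hasMFDerivAt
    have h5 : mfderiv (𝓡 m) (𝓡 m) ψ.symm (c t) a = chartField ψ a (ψ.symm (c t)) := by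
      have := (mdifferentiable_of_mem_maximalAtlas hψ).comp_symm_deriv hct
      rw [← chartField_mfderiv hψ hs (mfderiv (𝓡 m) (𝓡 m) ψ.symm (c t) a)]
      congr 1
      exact DFunLike.congr_fun this a
    have h6 := hg.mvfderiv_inner_chartField hψ ha hs v w
    rw [← h5] at h6
    obtain ⟨D, hD, hD'⟩ : ∃ D : ℝ →L[ℝ] ℝ,
        HasFDerivAt (fun t => H (ψ.symm (c t))) D t ∧ D 1 = 0 := by
      refine ⟨_, ((h2.comp (c t) h1).comp t (hc t)).hasFDerivAt, ?_⟩
      change mfderiv (𝓡 m) 𝓘(ℝ, ℝ) H (ψ.symm (c t)) (mfderiv (𝓡 m) (𝓡 m) ψ.symm (c t)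
        ((1 : ℝ) • a)) = 0
      rw [one_smul]
      exact h6
    exact hD' ▸ hD.hasDerivAt
  have := constant_of_has_deriv_right_zero (f := fun t => H (ψ.symm (c t))) (a := 0) (b := 1)
    (fun t ht => (hd t ht).continuousAt.continuousWithinAt)
    (fun t ht => (hd t (Ico_subset_Icc_self ht)).hasDerivWithinAt) 1 (by simp)
  simpa [H, c] using this

end SemiRiemannianMetric

/-! ### Constancy of the transverse metric along leaves. -/

namespace SemiRiemannianMetric

attribute [local instance] chartedSpaceSelf

variable {m k : ℕ} {M : Type u} [TopologicalSpace M]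
  [ChartedSpace (EuclideanSpace ℝ (Fin m)) M] [IsManifold (𝓡 m) ∞ M]
  {B : Type*} [TopologicalSpace B] [ChartedSpace (EuclideanSpace ℝ (Fin k)) B]
  [IsManifold (𝓡 k) ∞ B] {f : M → B} {g : SemiRiemannianMetric m M}

theorem inner_eq_of_sub_mem_radical (g : SemiRiemannianMetric m M) {x : M}
    {X X' Y Y' : TangentSpace (𝓡 m) x} (hX : X - X' ∈ g.radical x) (hY : Y - Y' ∈ g.radical x) :
    g.inner x X Y = g.inner x X' Y' := by
  have h1 := (g.mem_radical x _).1 hX Y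
  have h2 := (g.mem_radical x _).1 hY X'
  rw [map_sub, sub_apply, sub_eq_zero] at h1
  rw [map_sub, sub_apply, sub_eq_zero] at h2
  rw [h1, g.symm, h2, g.symm]

/-- The metrics at the points `x` and `y` of a fibre of `f` induce the same form on the tangent
space of the base. -/
def SameTransverse (g : SemiRiemannianMetric m M) (k : ℕ) {B : Type*} [TopologicalSpace B]
    [ChartedSpace (EuclideanSpace ℝ (Fin k)) B] (f : M → B) (x y : M) : Prop :=
  ∀ (X Y : TangentSpace (𝓡 m) x) (X' Y' : TangentSpace (𝓡 m) y),
    (mfderiv (𝓡 m) (𝓡 k) f x X : EuclideanSpace ℝ (Fin k)) = mfderiv (𝓡 m) (𝓡 k) f y X' →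
    (mfderiv (𝓡 m) (𝓡 k) f x Y : EuclideanSpace ℝ (Fin k)) = mfderiv (𝓡 m) (𝓡 k) f y Y' →
    g.inner x X Y = g.inner y X' Y'

omit [IsManifold (𝓡 k) ∞ B] in
theorem SameTransverse.symm {x y : M} (h : g.SameTransverse k f x y) : g.SameTransverse k f y x :=
  fun X Y X' Y' hX hY => (h X' Y' X Y hX.symm hY.symm).symm

/-- Surjectivity of `df` at the middle point supplies the tangent vectors through which the two
comparisons are chained. -/
theorem SameTransverse.trans (hf : Manifold.IsSubmersion (𝓡 m) (𝓡 k) ∞ f) {x y z : M}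
    (h : g.SameTransverse k f x y) (h' : g.SameTransverse k f y z) :
    g.SameTransverse k f x z := fun X Y X' Y' hX hY => by
  obtain ⟨X'', hX''⟩ := hf.surjective_mfderiv y
    (mfderiv (𝓡 m) (𝓡 k) f x X : EuclideanSpace ℝ (Fin k))
  obtain ⟨Y'', hY''⟩ := hf.surjective_mfderiv y
    (mfderiv (𝓡 m) (𝓡 k) f x Y : EuclideanSpace ℝ (Fin k))
  exact (h X Y X'' Y'' hX''.symm hY''.symm).trans (h' X'' Y'' X' Y' (hX''.trans hX) (hY''.trans hY))

omit [IsManifold (𝓡 k) ∞ B] in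
theorem SameTransverse.refl
    (hker : ∀ x v, mfderiv (𝓡 m) (𝓡 k) f x v = 0 → v ∈ g.radical x) (x : M) :
    g.SameTransverse k f x x := fun X Y X' Y' hX hY => by
  apply g.inner_eq_of_sub_mem_radical <;> apply hker <;> rw [map_sub, sub_eq_zero]
  exacts [hX, hY]

/-- A stationary metric is locally constant along the fibres of a submersion whose fibres are
tangent to the radical. -/
theorem IsStationary.eventually_sameTransverse (hg : g.IsStationary)
    (hf : Manifold.IsSubmersion (𝓡 m) (𝓡 k) ∞ f)
    (hker : ∀ x v, mfderiv (𝓡 m) (𝓡 k) f x v = 0 → v ∈ g.radical x) (x : M) :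
    ∀ᶠ y in 𝓝 x, f y = f x → g.SameTransverse k f x y := by
  obtain ⟨ψ, χ, P, R, hx, hψ, hχ, hmaps, hP, hR⟩ := hf.exists_charts x
  have hdχ := mdifferentiable_of_mem_maximalAtlas hχ
  have hdψ := mdifferentiable_of_mem_maximalAtlas hψ
  have hdf : ∀ y ∈ ψ.source, ∀ X : TangentSpace (𝓡 m) y,
      (mfderiv (𝓡 k) (𝓡 k) χ (f y) (mfderiv (𝓡 m) (𝓡 k) f y X) : EuclideanSpace ℝ (Fin k)) =
        P (mfderiv (𝓡 m) (𝓡 m) ψ y X) := by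
    intro y hy X
    have h1 := ((hdχ.mdifferentiableAt (hmaps hy)).hasMFDerivAt.comp y
      (hf.mdifferentiableAt y).hasMFDerivAt)
    have h2 := (P.hasMFDerivAt (x := ψ y)).comp y (hdψ.mdifferentiableAt hy).hasMFDerivAt
    have h3 := hasMFDerivAt_unique h1 (h2.congr_of_eventuallyEq
      (Filter.mem_of_superset (ψ.open_source.mem_nhds hy) hP))
    exact DFunLike.congr_fun h3 X
  have ha : ∀ a, P a = 0 → ∀ y ∈ ψ.source, chartField ψ a y ∈ g.radical y := by
    intro a ha y hy
    apply hker
    apply hdχ.mfderiv_injective (hmaps hy)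
    rw [map_zero]
    refine (hdf y hy _).trans ?_
    exact (congrArg P (mfderiv_chartField hψ hy a)).trans ha
  -- A ball is convex, so the chart segment from `ψ x` to `ψ y` stays in the target.
  obtain ⟨ε, hε, hball⟩ := Metric.isOpen_iff.1 ψ.open_target _ (ψ.map_source hx)
  have hψx : ∀ᶠ y in 𝓝 x, ψ y ∈ Metric.ball (ψ x) ε :=
    (ψ.continuousAt hx).eventually_mem (Metric.ball_mem_nhds _ hε)
  filter_upwards [ψ.open_source.mem_nhds hx, hψx] with y hy hyε hfy X Y X' Y' hX hY
  -- For `y` in the fibre of `x` the displacement is itself a radical direction.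
  have hPd : P (ψ y - ψ x) = 0 := by
    rw [map_sub, sub_eq_zero, ← hP x hx, ← hP y hy, hfy]
  have hconst := fun v w => hg.inner_chartField_eq hψ (ha _ hPd) (p := ψ x) (fun t ht => hball
    ((convex_ball (ψ x) ε).add_smul_sub_mem (Metric.mem_ball_self hε) hyε ht)) v w
  rw [add_sub_cancel, ψ.left_inv hx, ψ.left_inv hy] at hconst
  -- Carrying `Z` to `y` with the same coefficients preserves its image under `df`, so the result is
  -- `Z'` up to a radical vector.
  have hrad : ∀ (Z : TangentSpace (𝓡 m) x) (Z' : TangentSpace (𝓡 m) y),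
      (mfderiv (𝓡 m) (𝓡 k) f x Z : EuclideanSpace ℝ (Fin k)) = mfderiv (𝓡 m) (𝓡 k) f y Z' →
      chartField ψ (mfderiv (𝓡 m) (𝓡 m) ψ x Z) y - Z' ∈ g.radical y := by
    intro Z Z' hZ
    let A : EuclideanSpace ℝ (Fin m) := mfderiv (𝓡 m) (𝓡 m) ψ x Z
    let A' : EuclideanSpace ℝ (Fin m) := mfderiv (𝓡 m) (𝓡 m) ψ y Z'
    have h1 : chartField ψ A y - Z' = chartField ψ (A - A') y := by
      rw [chartField_sub, chartField_mfderiv hψ hy]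
    change chartField ψ A y - Z' ∈ _
    rw [h1]
    refine ha _ ?_ y hy
    rw [map_sub, sub_eq_zero]
    refine (hdf x hx Z).symm.trans (Eq.trans ?_ (hdf y hy Z'))
    rw [hfy]
    exact congrArg _ hZ
  rw [← g.inner_eq_of_sub_mem_radical (hrad X X' hX) (hrad Y Y' hY)]
  refine Eq.trans ?_ (hconst _ _).symm
  rw [chartField_mfderiv hψ hx, chartField_mfderiv hψ hx]

/-- The initial segment of a radical path is a radical path. -/
theorem radicalJoined_path {γ : ℝ → M} (hγ : ContMDiffOn 𝓘(ℝ, ℝ) (𝓡 m) 1 γ (Icc 0 1))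
    (hd : ∀ t ∈ Icc (0 : ℝ) 1,
      mfderivWithin 𝓘(ℝ, ℝ) (𝓡 m) γ (Icc 0 1) t (1 : ℝ) ∈ g.radical (γ t))
    {t : ℝ} (ht : t ∈ Icc (0 : ℝ) 1) : g.RadicalJoined (γ 0) (γ t) := by
  have hmaps : MapsTo (fun s : ℝ => s * t) (Icc 0 1) (Icc 0 1) := fun s hs =>
    ⟨mul_nonneg hs.1 ht.1, mul_le_one₀ hs.2 ht.1 ht.2⟩
  have hmul : ContDiff ℝ 1 (fun s : ℝ => s * t) := by fun_prop
  refine ⟨γ ∘ fun s => s * t, hγ.comp hmul.contMDiff.contMDiffOn hmaps, by simp, by simp,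
    fun s hs => ?_⟩
  have hu : UniqueMDiffWithinAt 𝓘(ℝ, ℝ) (Icc (0 : ℝ) 1) s :=
    (uniqueDiffOn_Icc_zero_one s hs).uniqueMDiffWithinAt
  have h1 : HasMFDerivWithinAt 𝓘(ℝ, ℝ) 𝓘(ℝ, ℝ) (fun s : ℝ => s * t) (Icc 0 1) s
      (ContinuousLinearMap.toSpanSingleton ℝ t) := by
    have : HasDerivAt (fun s : ℝ => s * t) t s := by
      simpa using (hasDerivAt_id s).mul_const t
    exact this.hasFDerivAt.hasMFDerivAt.hasMFDerivWithinAt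
  have h2 := ((hγ _ (hmaps hs)).mdifferentiableWithinAt one_ne_zero).hasMFDerivWithinAt
  have h3 := HasMFDerivWithinAt.comp (u := Icc 0 1) s h2 h1 hmaps
  rw [h3.mfderivWithin hu]
  have h4 (D : ℝ →L[ℝ] EuclideanSpace ℝ (Fin m)) : D ((1 : ℝ) • t) = t • D 1 := by
    rw [← map_smul]; simp
  refine (congrArg (· ∈ g.radical (γ (s * t)))
    (h4 (mfderivWithin 𝓘(ℝ, ℝ) (𝓡 m) γ (Icc 0 1) (s * t)))).mpr ?_
  exact (g.radical (γ (s * t))).smul_mem t (hd _ (hmaps hs))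

/-- The local comparison propagates along a radical path because `[0, 1]` is preconnected and the
relation is symmetric and transitive. -/
theorem IsStationary.sameTransverse (hg : g.IsStationary)
    (hf : Manifold.IsSubmersion (𝓡 m) (𝓡 k) ∞ f)
    (hker : ∀ x v, mfderiv (𝓡 m) (𝓡 k) f x v = 0 → v ∈ g.radical x)
    (hleaf : ∀ x y, g.leafSetoid x y → f x = f y) {x y : M} (hxy : g.leafSetoid x y) :
    g.SameTransverse k f x y := by
  induction hxy with
  | rel x y h =>
    obtain ⟨γ, hγ, rfl, rfl, hd⟩ := h
    -- The local comparison applies only within a fibre, so the whole path, not just its endpoints,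
    -- must lie in one.
    have hfγ : ∀ t ∈ Icc (0 : ℝ) 1, f (γ t) = f (γ 0) := fun t ht =>
      (hleaf _ _ (Relation.EqvGen.rel _ _ (radicalJoined_path hγ hd ht))).symm
    refine isPreconnected_Icc.induction₂ (fun s t => g.SameTransverse k f (γ s) (γ t))
      (fun s hs => ?_) (fun _ _ _ _ _ _ h h' => h.trans hf h') (fun _ _ _ _ h => h.symm)
      (left_mem_Icc.2 zero_le_one) (right_mem_Icc.2 zero_le_one)
    filter_upwards [(hγ.continuousOn s hs).eventually (hg.eventually_sameTransverse hf hker (γ s)),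
      self_mem_nhdsWithin] with t h ht
    exact h ((hfγ t ht).trans (hfγ s hs).symm)
  | refl x => exact .refl hker x
  | symm x y _ ih => exact ih.symm
  | trans x y z _ _ h h' => exact h.trans hf h'

end SemiRiemannianMetric

/-! ### The induced metric on the leaf space. -/

namespace SemiRiemannianMetric

variable {m k : ℕ} {M : Type u} [TopologicalSpace M]
  [ChartedSpace (EuclideanSpace ℝ (Fin m)) M] [IsManifold (𝓡 m) ∞ M]
  {g : SemiRiemannianMetric m M}

theorem surjective_leafProj (g : SemiRiemannianMetric m M) : Function.Surjective g.leafProj :=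
  Quotient.mk_surjective

theorem leafProj_eq_iff {x y : M} : g.leafProj x = g.leafProj y ↔ g.leafSetoid x y :=
  Quotient.eq

variable [ChartedSpace (EuclideanSpace ℝ (Fin k)) g.LeafSpace] [IsManifold (𝓡 k) ∞ g.LeafSpace]

/-- The kernel of the differential of the projection onto the leaf space is the radical. -/
theorem IsSimple.mfderiv_leafProj_eq_zero_iff (hgs : g.IsSimple)
    (hπ : Manifold.IsSubmersion (𝓡 m) (𝓡 k) ∞ g.leafProj) (x : M) (v : TangentSpace (𝓡 m) x) :
    mfderiv (𝓡 m) (𝓡 k) g.leafProj x v = 0 ↔ v ∈ g.radical x := by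
  obtain ⟨d, B, _, _, _, _, f, hf, hfib, hker⟩ := hgs
  rw [← hker x, LinearMap.mem_ker]
  -- `leafProj` and the submersion `f` witnessing simplicity have the same fibres, so each kernel
  -- contains the other.
  exact ⟨fun h => hπ.mfderiv_eq_zero (hf.mdifferentiableAt x)
      (fun y z hyz => (hfib y z).2 (leafProj_eq_iff.1 hyz)) h,
    fun h => hf.mfderiv_eq_zero (hπ.mdifferentiableAt x)
      (fun y z hyz => leafProj_eq_iff.2 ((hfib y z).1 hyz)) h⟩

theorem IsInducedMetric.unique (hπ : Manifold.IsSubmersion (𝓡 m) (𝓡 k) ∞ g.leafProj)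
    {b₁ b₂ : ∀ b : g.LeafSpace, LinearMap.BilinForm ℝ (TangentSpace (𝓡 k) b)}
    (h₁ : g.IsInducedMetric b₁) (h₂ : g.IsInducedMetric b₂) : b₁ = b₂ := by
  funext b
  obtain ⟨x, rfl⟩ := g.surjective_leafProj b
  refine LinearMap.ext fun X => LinearMap.ext fun Y => ?_
  obtain ⟨X, rfl⟩ := hπ.surjective_mfderiv x X
  obtain ⟨Y, rfl⟩ := hπ.surjective_mfderiv x Y
  rw [h₁, h₂]

/-- Over each leaf, `g` at one chosen point is pulled back along a linear right inverse of the
differential; `sameTransverse` gives the required identity at all other points of the leaf. -/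
theorem IsStationary.exists_isInducedMetric (hg : g.IsStationary) (hgs : g.IsSimple)
    (hπ : Manifold.IsSubmersion (𝓡 m) (𝓡 k) ∞ g.leafProj) :
    ∃ gbar : ∀ b : g.LeafSpace, LinearMap.BilinForm ℝ (TangentSpace (𝓡 k) b),
      g.IsInducedMetric gbar := by
  have key : ∀ b : g.LeafSpace, ∃ β : LinearMap.BilinForm ℝ (EuclideanSpace ℝ (Fin k)),
      ∀ x, g.leafProj x = b → ∀ X Y : TangentSpace (𝓡 m) x,
        β (mfderiv (𝓡 m) (𝓡 k) g.leafProj x X) (mfderiv (𝓡 m) (𝓡 k) g.leafProj x Y) =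
          g.inner x X Y := by
    intro b
    obtain ⟨x, rfl⟩ := g.surjective_leafProj b
    let D : EuclideanSpace ℝ (Fin m) →ₗ[ℝ] EuclideanSpace ℝ (Fin k) :=
      (mfderiv (𝓡 m) (𝓡 k) g.leafProj x).toLinearMap
    obtain ⟨R, hR⟩ := D.exists_rightInverse_of_surjective
      (LinearMap.range_eq_top.2 (hπ.surjective_mfderiv x))
    have hR' (v) : D (R v) = v := DFunLike.congr_fun hR v
    refine ⟨LinearMap.compl₁₂ (g.form x : LinearMap.BilinForm ℝ (EuclideanSpace ℝ (Fin m))) R R,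
      fun y hy X Y => ?_⟩
    exact hg.sameTransverse hπ (fun x v => (hgs.mfderiv_leafProj_eq_zero_iff hπ x v).1)
      (fun _ _ => leafProj_eq_iff.2) (leafProj_eq_iff.1 hy.symm) _ _ X Y (hR' _) (hR' _)
  choose β hβ using key
  exact ⟨β, fun x X Y => hβ _ x rfl X Y⟩

theorem IsStationary.existsUnique_isInducedMetric (hg : g.IsStationary) (hgs : g.IsSimple)
    (hπ : Manifold.IsSubmersion (𝓡 m) (𝓡 k) ∞ g.leafProj) :
    ∃! gbar : ∀ b : g.LeafSpace, LinearMap.BilinForm ℝ (TangentSpace (𝓡 k) b),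
      g.IsInducedMetric gbar := by
  obtain ⟨gbar, h⟩ := hg.exists_isInducedMetric hgs hπ
  exact ⟨gbar, h, fun _ h' => h'.unique hπ h⟩

/-- The quotient tangent space is the tangent space of the leaf space. -/
noncomputable def quotEquiv (hgs : g.IsSimple)
    (hπ : Manifold.IsSubmersion (𝓡 m) (𝓡 k) ∞ g.leafProj) (x : M) :
    (TangentSpace (𝓡 m) x ⧸ g.radical x) ≃ₗ[ℝ] TangentSpace (𝓡 k) (g.leafProj x) :=
  (Submodule.quotEquivOfEq _ _ (Submodule.ext fun v =>
    (hgs.mfderiv_leafProj_eq_zero_iff hπ x v).symm)).trans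
  ((mfderiv (𝓡 m) (𝓡 k) g.leafProj x).toLinearMap.quotKerEquivOfSurjective
    (hπ.surjective_mfderiv x))

theorem IsInducedMetric.apply_quotEquiv (hgs : g.IsSimple)
    (hπ : Manifold.IsSubmersion (𝓡 m) (𝓡 k) ∞ g.leafProj)
    {gbar : ∀ b : g.LeafSpace, LinearMap.BilinForm ℝ (TangentSpace (𝓡 k) b)}
    (h : g.IsInducedMetric gbar) (x : M) (v w : TangentSpace (𝓡 m) x ⧸ g.radical x) :
    gbar (g.leafProj x) (quotEquiv hgs hπ x v) (quotEquiv hgs hπ x w) = g.quotForm x v w := by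
  induction v using Submodule.Quotient.induction_on with
  | _ v =>
    induction w using Submodule.Quotient.induction_on with
    | _ w => exact h x v w

theorem IsInducedMetric.nondegenerate (hgs : g.IsSimple)
    (hπ : Manifold.IsSubmersion (𝓡 m) (𝓡 k) ∞ g.leafProj)
    {gbar : ∀ b : g.LeafSpace, LinearMap.BilinForm ℝ (TangentSpace (𝓡 k) b)}
    (h : g.IsInducedMetric gbar) (b : g.LeafSpace) : (gbar b).Nondegenerate := by
  obtain ⟨x, rfl⟩ := g.surjective_leafProj b
  have hn := g.quotForm_nondegenerate x
  refine ⟨fun v hv => ?_, fun v hv => ?_⟩ <;>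
    obtain ⟨v, rfl⟩ := (quotEquiv hgs hπ x).surjective v <;>
    rw [LinearEquiv.map_eq_zero_iff]
  · exact hn.1 v fun w => by rw [← h.apply_quotEquiv hgs hπ]; exact hv _
  · exact hn.2 v fun w => by rw [← h.apply_quotEquiv hgs hπ]; exact hv _

end SemiRiemannianMetric

/-! ### The induced map and its conformality. -/

section Maps

variable {m n k l : ℕ} {M : Type u} [TopologicalSpace M]
  [ChartedSpace (EuclideanSpace ℝ (Fin m)) M] [IsManifold (𝓡 m) ∞ M]
  {N : Type v} [TopologicalSpace N]
  [ChartedSpace (EuclideanSpace ℝ (Fin n)) N] [IsManifold (𝓡 n) ∞ N]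
  {g : SemiRiemannianMetric m M} {h : SemiRiemannianMetric n N}
  [ChartedSpace (EuclideanSpace ℝ (Fin k)) g.LeafSpace] [IsManifold (𝓡 k) ∞ g.LeafSpace]
  [ChartedSpace (EuclideanSpace ℝ (Fin l)) h.LeafSpace] [IsManifold (𝓡 l) ∞ h.LeafSpace]
  {φ : M → N}

omit [IsManifold (𝓡 k) ∞ g.LeafSpace] [IsManifold (𝓡 l) ∞ h.LeafSpace] in
theorem contMDiff_leafMap (hπM : Manifold.IsSubmersion (𝓡 m) (𝓡 k) ∞ g.leafProj)
    (hπN : Manifold.IsSubmersion (𝓡 n) (𝓡 l) ∞ h.leafProj)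
    (hφ : ContMDiff (𝓡 m) (𝓡 n) 1 φ) (hrad : IsRadicalPreserving g h φ) :
    ContMDiff (𝓡 k) (𝓡 l) 1 (leafMap hφ hrad) := by
  intro b
  obtain ⟨x, rfl⟩ := g.surjective_leafProj b
  refine hπM.contMDiffAt_of_comp (r := 1) x ?_
  -- The composite with `g.leafProj` is by definition `h.leafProj ∘ φ`.
  exact ((hπN.contMDiff (φ x)).of_le (by exact_mod_cast le_top)).comp x (hφ x)

/-- Under the identification of the quotient tangent spaces with the tangent spaces of the leaf
spaces, the generalized differential is the differential of the induced map. -/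
theorem mfderiv_leafMap_quotEquiv (hgs : g.IsSimple) (hhs : h.IsSimple)
    (hπM : Manifold.IsSubmersion (𝓡 m) (𝓡 k) ∞ g.leafProj)
    (hπN : Manifold.IsSubmersion (𝓡 n) (𝓡 l) ∞ h.leafProj)
    (hφ : ContMDiff (𝓡 m) (𝓡 n) 1 φ) (hrad : IsRadicalPreserving g h φ) (x : M)
    (v : TangentSpace (𝓡 m) x ⧸ g.radical x) :
    mfderiv (𝓡 k) (𝓡 l) (leafMap hφ hrad) (g.leafProj x)
      (SemiRiemannianMetric.quotEquiv hgs hπM x v) =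
      SemiRiemannianMetric.quotEquiv hhs hπN (φ x) (genDifferential hrad x v) := by
  induction v using Submodule.Quotient.induction_on with
  | _ v =>
    have h1 := (((contMDiff_leafMap hπM hπN hφ hrad).mdifferentiable one_ne_zero
      (g.leafProj x)).hasMFDerivAt).comp x (hπM.mdifferentiableAt x).hasMFDerivAt
    have h2 := (hπN.mdifferentiableAt (φ x)).hasMFDerivAt.comp x
      (hφ.mdifferentiable one_ne_zero x).hasMFDerivAt
    exact DFunLike.congr_fun (hasMFDerivAt_unique h1 h2) v

theorem isGenHWC_iff_isHWC_leafMap (hgs : g.IsSimple) (hhs : h.IsSimple)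
    (hπM : Manifold.IsSubmersion (𝓡 m) (𝓡 k) ∞ g.leafProj)
    (hπN : Manifold.IsSubmersion (𝓡 n) (𝓡 l) ∞ h.leafProj)
    (hφ : ContMDiff (𝓡 m) (𝓡 n) 1 φ) (hrad : IsRadicalPreserving g h φ)
    {gbar : ∀ b : g.LeafSpace, LinearMap.BilinForm ℝ (TangentSpace (𝓡 k) b)}
    {hbar : ∀ b : h.LeafSpace, LinearMap.BilinForm ℝ (TangentSpace (𝓡 l) b)}
    (hgbar : g.IsInducedMetric gbar) (hhbar : h.IsInducedMetric hbar) :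
    IsGenHWC hrad ↔ IsHWC gbar hbar (leafMap hφ hrad) := by
  have key (x : M) (c : ℝ) :
      IsHWCLinear (g.quotForm x) (h.quotForm (φ x)) (genDifferential hrad x) c ↔
      IsHWCLinear (gbar (g.leafProj x)) (hbar (leafMap hφ hrad (g.leafProj x)))
        (mfderiv (𝓡 k) (𝓡 l) (leafMap hφ hrad) (g.leafProj x)).toLinearMap c :=
    isHWCLinear_iff_of_equiv (SemiRiemannianMetric.quotEquiv hgs hπM x)
      (SemiRiemannianMetric.quotEquiv hhs hπN (φ x)) (hgbar.apply_quotEquiv hgs hπM x)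
      (hhbar.apply_quotEquiv hhs hπN (φ x)) (mfderiv_leafMap_quotEquiv hgs hhs hπM hπN hφ hrad x)
  constructor
  · rintro ⟨Λ, hΛ⟩
    -- `Λ` need not be constant on leaves (it is arbitrary where the target quotient is zero), so
    -- its value at one chosen point of each leaf is used.
    refine ⟨fun b => Λ (Function.surjInv g.surjective_leafProj b), fun b => ?_⟩
    -- The value of `Λ` is recorded before `b` is replaced by `g.leafProj x`, since `surjInv` at
    -- that leaf need not reduce to `x`.
    obtain ⟨x, rfl, hx⟩ : ∃ x, g.leafProj x = b ∧
        Λ x = Λ (Function.surjInv g.surjective_leafProj b) :=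
      ⟨_, Function.surjInv_eq g.surjective_leafProj b, rfl⟩
    have hxΛ := hΛ x
    rw [hx] at hxΛ
    exact (key x _).1 hxΛ
  · rintro ⟨Λ, hΛ⟩
    exact ⟨fun x => Λ (g.leafProj x), fun x => (key x _).2 (hΛ _)⟩

end Maps

theorem mainTheorem4
    {m n k l : ℕ}
    {M : Type u} [TopologicalSpace M] [T2Space M] [SecondCountableTopology M]
    [ChartedSpace (EuclideanSpace ℝ (Fin m)) M] [IsManifold (𝓡 m) ∞ M]
    {N : Type v} [TopologicalSpace N] [T2Space N] [SecondCountableTopology N]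
    [ChartedSpace (EuclideanSpace ℝ (Fin n)) N] [IsManifold (𝓡 n) ∞ N]
    (g : SemiRiemannianMetric m M) (h : SemiRiemannianMetric n N)
    (hg : g.IsStationary) (hh : h.IsStationary)
    -- the radical foliations are simple, and the leaf spaces carry their smooth structure
    (hgs : g.IsSimple) (hhs : h.IsSimple)
    [ChartedSpace (EuclideanSpace ℝ (Fin k)) g.LeafSpace] [IsManifold (𝓡 k) ∞ g.LeafSpace]
    [ChartedSpace (EuclideanSpace ℝ (Fin l)) h.LeafSpace] [IsManifold (𝓡 l) ∞ h.LeafSpace]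
    (hπM : Manifold.IsSubmersion (𝓡 m) (𝓡 k) ∞ g.leafProj)
    (hπN : Manifold.IsSubmersion (𝓡 n) (𝓡 l) ∞ h.leafProj)
    (φ : M → N) (hφ : ContMDiff (𝓡 m) (𝓡 n) 1 φ) (hrad : IsRadicalPreserving g h φ) :
    -- the induced map and the induced metrics are well defined
    ContMDiff (𝓡 k) (𝓡 l) 1 (leafMap hφ hrad) ∧
    (∃! gbar : ∀ b : g.LeafSpace, LinearMap.BilinForm ℝ (TangentSpace (𝓡 k) b),
      g.IsInducedMetric gbar) ∧
    (∃! hbar : ∀ b : h.LeafSpace, LinearMap.BilinForm ℝ (TangentSpace (𝓡 l) b),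
      h.IsInducedMetric hbar) ∧
    ∀ (gbar : ∀ b : g.LeafSpace, LinearMap.BilinForm ℝ (TangentSpace (𝓡 k) b))
      (hbar : ∀ b : h.LeafSpace, LinearMap.BilinForm ℝ (TangentSpace (𝓡 l) b)),
      g.IsInducedMetric gbar → h.IsInducedMetric hbar →
      (∀ b, (gbar b).Nondegenerate) ∧ (∀ b, (hbar b).Nondegenerate) ∧
      (IsGenHWC hrad ↔ IsHWC gbar hbar (leafMap hφ hrad)) := by
  exact ⟨contMDiff_leafMap hπM hπN hφ hrad, hg.existsUnique_isInducedMetric hgs hπM,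
    hh.existsUnique_isInducedMetric hhs hπN, fun gbar hbar hgbar hhbar =>
    ⟨hgbar.nondegenerate hgs hπM, hhbar.nondegenerate hhs hπN,
      isGenHWC_iff_isHWC_leafMap hgs hhs hπM hπN hφ hrad hgbar hhbar⟩⟩
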